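/- Let $K$ be an algebraically closed field of characteristic $0$, let $n,k\ge 0$ be integers, and let $X\subset\mathbb P^n=\mathbb P^n_K$ be an irreducible Zariski closed subset of dimension $k$. For $p\in X$ let $T_p(X)\subset\mathbb P^n$ denote the embedded projective tangent space of $X$ at $p$: if $CX\subset K^{n+1}$ is the affine cone over $X$ and $q\in K^{n+1}\setminus\{0\}$ is any vector lying over $p$, then $T_p(X)$ is the projective space of one-dimensional subspaces of the Zariski tangent space $\{v\in K^{n+1} : \sum_i \frac{\partial f}{\partial x_i}(q)\,v_i=0 \text{ for every polynomial } f \text{ vanishing on } CX\}$. Suppose that there are a $(k-1)$-dimensional linear subspace $L\subset\mathbb P^n$ (with $L=\emptyset$ if $k=0$) and a dense open subset $U_0$ of $X$ such that $L\subset T_p(X)$ for all $p\in U_0$. Then $X$ is a $k$-dimensional linear subspace of $\mathbb P^n$ containing $L$. -/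

import Mathlib

noncomputable section

namespace ProjVar

open MvPolynomial

variable {K : Type*} [Field K] {n : ℕ}

/-- Projective `n`-space over `K`: the one-dimensional subspaces of `K ^ (n + 1)`. -/
abbrev ProjSpace (K : Type*) [Field K] (n : ℕ) : Type _ :=
  Projectivization K (Fin (n + 1) → K)

/-- The common zeros in projective space of a set `S` of polynomials. It is used only for sets of
homogeneous polynomials, for which it does not depend on the chosen coordinate vectors
(see `eval_rep_mk_eq_zero_iff`). -/
def projZeroLocus (S : Set (MvPolynomial (Fin (n + 1)) K)) : Set (ProjSpace K n) :=
  {p | ∀ f ∈ S, eval p.rep f = 0}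

/-- A subset of projective space is Zariski closed if it is the set of common zeros of some set of
homogeneous polynomials. -/
def IsZariskiClosed (Z : Set (ProjSpace K n)) : Prop :=
  ∃ S : Set (MvPolynomial (Fin (n + 1)) K),
    (∀ f ∈ S, ∃ d : ℕ, f.IsHomogeneous d) ∧ Z = projZeroLocus S

theorem eval_smul_of_isHomogeneous {f : MvPolynomial (Fin (n + 1)) K} {d : ℕ}
    (hf : f.IsHomogeneous d) (c : K) (v : Fin (n + 1) → K) :
    eval (c • v) f = c ^ d * eval v f := by
  rw [eval_eq, eval_eq, Finset.mul_sum]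
  refine Finset.sum_congr rfl fun s hs => ?_
  have h := hf (mem_support_iff.mp hs)
  have h2 : ∑ i ∈ s.support, s i = d := by
    simpa [Finsupp.weight_apply, Finsupp.sum] using h
  simp only [Pi.smul_apply, smul_eq_mul, mul_pow, Finset.prod_mul_distrib]
  rw [Finset.prod_pow_eq_pow_sum, h2]
  ring

/-- The vanishing of a homogeneous polynomial at a point of projective space may be tested on any
vector of homogeneous coordinates. -/
theorem eval_rep_mk_eq_zero_iff {f : MvPolynomial (Fin (n + 1)) K} {d : ℕ}
    (hf : f.IsHomogeneous d) (v : Fin (n + 1) → K) (hv : v ≠ 0) :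
    eval (Projectivization.mk K v hv).rep f = 0 ↔ eval v f = 0 := by
  obtain ⟨a, ha⟩ := Projectivization.exists_smul_eq_mk_rep K v hv
  rw [← ha, Units.smul_def, eval_smul_of_isHomogeneous hf]
  simp

/-- The Zariski topology on projective space. -/
instance zariskiTopology : TopologicalSpace (ProjSpace K n) :=
  TopologicalSpace.ofClosed {Z | IsZariskiClosed Z}
    ⟨{1}, by
      intro f hf
      rw [Set.mem_singleton_iff] at hf
      exact ⟨0, hf ▸ isHomogeneous_one _ _⟩, by
      ext p
      simp [projZeroLocus]⟩
    (by
      intro A hA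
      refine ⟨{f | (∃ d : ℕ, f.IsHomogeneous d) ∧ ∃ Z ∈ A, ∀ p ∈ Z, eval p.rep f = 0},
        fun f hf => hf.1, ?_⟩
      ext p
      constructor
      · rintro hp f ⟨-, Z, hZ, hf⟩
        exact hf p (hp Z hZ)
      · intro hp Z hZ
        obtain ⟨S, hS, rfl⟩ := hA hZ
        intro f hf
        exact hp f ⟨hS f hf, _, hZ, fun q hq => hq f hf⟩)
    (by
      rintro Z ⟨S, hS, rfl⟩ W ⟨T, hT, rfl⟩
      refine ⟨{h | ∃ f ∈ S, ∃ g ∈ T, h = f * g}, ?_, ?_⟩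
      · rintro h ⟨f, hf, g, hg, rfl⟩
        obtain ⟨d, hd⟩ := hS f hf
        obtain ⟨e, he⟩ := hT g hg
        exact ⟨d + e, hd.mul he⟩
      · ext p
        constructor
        · rintro (hp | hp) h ⟨f, hf, g, hg, rfl⟩
          · simp [hp f hf]
          · simp [hp g hg]
        · intro hp
          by_contra hcon
          simp only [Set.mem_union, not_or, projZeroLocus, Set.mem_ofPred_eq, not_forall] at hcon
          obtain ⟨⟨f, hf, hf0⟩, g, hg, hg0⟩ := hcon
          have h := hp (f * g) ⟨f, hf, g, hg, rfl⟩
          rw [map_mul, mul_eq_zero] at h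
          exact h.elim hf0 hg0)

theorem isClosed_iff {Z : Set (ProjSpace K n)} : IsClosed Z ↔ IsZariskiClosed Z := by
  rw [← isOpen_compl_iff]
  change IsZariskiClosed Zᶜᶜ ↔ _
  rw [compl_compl]

/-- A linear subspace of projective space has (projective) dimension `d` if the vector subspace
it comes from has dimension `d + 1`; the empty linear subspace has dimension `-1`. -/
def HasProjDim (L : Projectivization.Subspace K (Fin (n + 1) → K)) (d : ℤ) : Prop :=
  (Module.finrank K (Projectivization.Subspace.submodule L) : ℤ) = d + 1

/-- The affine cone over a subset `X` of projective space: the origin and all vectors of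
homogeneous coordinates of points of `X`. -/
def affineCone (X : Set (ProjSpace K n)) : Set (Fin (n + 1) → K) :=
  {v | ∀ hv : v ≠ 0, Projectivization.mk K v hv ∈ X}

/-- The Zariski tangent space at `q` of a subset `S` of affine space, inside the ambient vector
space: the common kernel of the differentials at `q` of all polynomials vanishing on `S`. -/
def zariskiTangentSpace (S : Set (Fin (n + 1) → K)) (q : Fin (n + 1) → K) :
    Submodule K (Fin (n + 1) → K) where
  carrier := {v | ∀ f ∈ vanishingIdeal K S, ∑ i, eval q (pderiv i f) * v i = 0}
  zero_mem' := by simp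
  add_mem' := by
    intro v w hv hw f hf
    simp only [Pi.add_apply, mul_add, Finset.sum_add_distrib, hv f hf, hw f hf, add_zero]
  smul_mem' := by
    intro c v hv f hf
    have h : ∀ i, eval q (pderiv i f) * (c • v) i = c * (eval q (pderiv i f) * v i) := by
      intro i
      simp only [Pi.smul_apply, smul_eq_mul]
      ring
    simp only [h, ← Finset.mul_sum, hv f hf, mul_zero]

/-- The embedded projective tangent space of `X` at `p`: the projective space of one-dimensional
subspaces of the Zariski tangent space of the affine cone over `X` at a vector lying over `p`.
It does not depend on that vector (see `zariskiTangentSpace_affineCone_smul`). -/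
def embeddedTangentSpace (X : Set (ProjSpace K n)) (p : ProjSpace K n) :
    Projectivization.Subspace K (Fin (n + 1) → K) :=
  Projectivization.Subspace.submodule.symm (zariskiTangentSpace (affineCone X) p.rep)

theorem smul_mem_affineCone {X : Set (ProjSpace K n)} {v : Fin (n + 1) → K}
    (hv : v ∈ affineCone X) (c : K) : c • v ∈ affineCone X := by
  intro hcv
  have hc : c ≠ 0 := fun h => hcv (by simp [h])
  have hv0 : v ≠ 0 := fun h => hcv (by simp [h])
  have h : Projectivization.mk K (c • v) hcv = Projectivization.mk K v hv0 :=
    (Projectivization.mk_eq_mk_iff' K _ _ _ _).mpr ⟨c, rfl⟩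
  rw [h]
  exact hv hv0

theorem zariskiTangentSpace_affineCone_le (X : Set (ProjSpace K n)) (q : Fin (n + 1) → K)
    {c : K} (hc : c ≠ 0) :
    zariskiTangentSpace (affineCone X) (c • q) ≤ zariskiTangentSpace (affineCone X) q := by
  intro v hv f hf
  have key : ∀ (g : MvPolynomial (Fin (n + 1)) K) (i : Fin (n + 1)),
      pderiv i (aeval (fun j => C c⁻¹ * MvPolynomial.X j) g) =
        C c⁻¹ * aeval (fun j => C c⁻¹ * MvPolynomial.X j) (pderiv i g) := by
    intro g i
    induction g using MvPolynomial.induction_on with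
    | C a => simp
    | add p q hp hq => simp only [map_add, hp, hq, mul_add]
    | mul_X p j hp =>
      simp only [map_mul, Derivation.leibniz, hp, aeval_X, map_add, smul_eq_mul, pderiv_C,
        pderiv_X]
      by_cases hij : j = i
      · subst hij
        simp only [Pi.single_eq_same, map_one]
        ring
      · simp only [Pi.single_eq_of_ne hij, map_zero]
        ring
  have hev : ∀ (g : MvPolynomial (Fin (n + 1)) K) (w : Fin (n + 1) → K),
      eval w (aeval (fun j => C c⁻¹ * MvPolynomial.X j) g) = eval (c⁻¹ • w) g := by
    intro g w
    induction g using MvPolynomial.induction_on with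
    | C a => simp
    | add p q hp hq => simp only [map_add, hp, hq]
    | mul_X p j hp =>
      simp only [map_mul, hp, aeval_X, eval_X, eval_C, Pi.smul_apply, smul_eq_mul]
  have hmem : aeval (fun j => C c⁻¹ * MvPolynomial.X j) f ∈ vanishingIdeal K (affineCone X) := by
    intro w hw
    have h := hf _ (smul_mem_affineCone hw c⁻¹)
    rw [aeval_eq_eval] at h ⊢
    exact (hev f w).trans h
  have h := hv _ hmem
  simp only [key, map_mul, eval_C, hev, smul_smul, inv_mul_cancel₀ hc, one_smul, mul_assoc,
    ← Finset.mul_sum] at h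
  exact (mul_eq_zero.mp h).resolve_left (inv_ne_zero hc)

/-- The tangent space of an affine cone is the same at all vectors over a given point. -/
theorem zariskiTangentSpace_affineCone_smul (X : Set (ProjSpace K n)) (q : Fin (n + 1) → K)
    {c : K} (hc : c ≠ 0) :
    zariskiTangentSpace (affineCone X) (c • q) = zariskiTangentSpace (affineCone X) q := by
  refine le_antisymm (zariskiTangentSpace_affineCone_le X q hc) ?_
  have h := zariskiTangentSpace_affineCone_le X (c • q) (inv_ne_zero hc)
  rwa [smul_smul, inv_mul_cancel₀ hc, one_smul] at h

end ProjVar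

end

noncomputable section

namespace ProjVar

open MvPolynomial TopologicalSpace

variable {K : Type*} [Field K] {n : ℕ}

/-! Let `W` be the vector space of `L` and `I` the ideal of the cone over `X`. For `w ∈ W` and `f ∈
I`, tangency makes the derivative of `f` along `w` vanish over `U₀`, hence over `X` by density. So
differentiation along `w` preserves `I` (`directionalDeriv_mem_vanishingIdeal`), and by Taylor's
formula in characteristic 0 the cone is stable under translation by `W` (`add_mem_affineCone`).

Since `dim X = k > dim L`, the cone has a vector `x` outside `W`. It then contains `W + Kx`, of
dimension `k + 1`, so `X` contains a `k`-dimensional linear subspace and equals it by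
irreducibility.

Dimension being Krull dimension, this needs two bounds: a flag of subspaces shows that a
`k`-dimensional linear subspace has height at least `k`, and chains of irreducible closed sets in
`L` become chains of primes in a polynomial ring in `k` variables. -/

/-! ### The ideal of the affine cone -/

theorem eval_smul_eq_sum_homogeneousComponent (g : MvPolynomial (Fin (n + 1)) K) (c : K)
    (v : Fin (n + 1) → K) :
    eval (c • v) g =
      ∑ i ∈ Finset.range (g.totalDegree + 1), c ^ i * eval v (homogeneousComponent i g) := by
  conv_lhs => rw [← sum_homogeneousComponent g, map_sum]
  exact Finset.sum_congr rfl fun i _ =>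
    eval_smul_of_isHomogeneous (homogeneousComponent_isHomogeneous i g) c v

/-- A polynomial vanishes on the punctured line through `v` if and only if all its homogeneous
components vanish at `v`. -/
theorem forall_ne_zero_eval_smul_iff [Infinite K] (g : MvPolynomial (Fin (n + 1)) K)
    (v : Fin (n + 1) → K) :
    (∀ c : K, c ≠ 0 → eval (c • v) g = 0) ↔ ∀ i, eval v (homogeneousComponent i g) = 0 := by
  refine ⟨fun h i => ?_, fun h c _ => by simp [eval_smul_eq_sum_homogeneousComponent, h]⟩
  -- `P` is `g (c • v)` as a polynomial in `c`; it has infinitely many roots.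
  set P : Polynomial K := ∑ i ∈ Finset.range (g.totalDegree + 1),
    Polynomial.monomial i (eval v (homogeneousComponent i g)) with hP
  have hroot : P = 0 := by
    refine P.eq_zero_of_infinite_isRoot
      ((Set.infinite_univ.sdiff (Set.finite_singleton (0 : K))).mono fun c hc => ?_)
    have := h c (by simpa using hc)
    rw [eval_smul_eq_sum_homogeneousComponent] at this
    simpa [hP, Polynomial.eval_finsetSum, mul_comm] using this
  by_cases hi : i < g.totalDegree + 1
  · have := congrArg (fun Q => Polynomial.coeff Q i) hroot
    simpa [hP, Polynomial.finsetSum_coeff, Polynomial.coeff_monomial, Nat.lt_succ_iff.mp hi]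
      using this
  · rw [homogeneousComponent_eq_zero _ _ (by omega), map_zero]

/-- The points of projective space over which a polynomial vanishes identically. -/
def lineZeroLocus (g : MvPolynomial (Fin (n + 1)) K) : Set (ProjSpace K n) :=
  {p | ∀ c : K, c ≠ 0 → eval (c • p.rep) g = 0}

theorem isClosed_lineZeroLocus [Infinite K] (g : MvPolynomial (Fin (n + 1)) K) :
    IsClosed (lineZeroLocus g) := by
  rw [isClosed_iff]
  refine ⟨Set.range fun i => homogeneousComponent i g, ?_, ?_⟩
  · rintro _ ⟨i, rfl⟩
    exact ⟨i, homogeneousComponent_isHomogeneous i g⟩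
  · ext p
    simp [lineZeroLocus, projZeroLocus, forall_ne_zero_eval_smul_iff]

theorem smul_rep_mem_affineCone {X : Set (ProjSpace K n)} {p : ProjSpace K n} (hp : p ∈ X)
    (c : K) : c • p.rep ∈ affineCone X := by
  refine smul_mem_affineCone (fun hv => ?_) c
  rwa [Projectivization.mk_rep]

theorem zero_mem_affineCone (X : Set (ProjSpace K n)) : 0 ∈ affineCone X := fun h => (h rfl).elim

theorem mem_affineCone_iff_mk_mem {X : Set (ProjSpace K n)} {v : Fin (n + 1) → K} (hv : v ≠ 0) :
    v ∈ affineCone X ↔ Projectivization.mk K v hv ∈ X :=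
  ⟨fun h => h hv, fun h _ => h⟩

theorem rep_mem_affineCone_iff {X : Set (ProjSpace K n)} {p : ProjSpace K n} :
    p.rep ∈ affineCone X ↔ p ∈ X := by
  rw [mem_affineCone_iff_mk_mem p.rep_nonzero, Projectivization.mk_rep]

theorem mem_vanishingIdeal_affineCone_iff [Infinite K] {X : Set (ProjSpace K n)}
    (hX : X.Nonempty) {g : MvPolynomial (Fin (n + 1)) K} :
    g ∈ vanishingIdeal K (affineCone X) ↔ X ⊆ lineZeroLocus g := by
  simp only [mem_vanishingIdeal_iff, aeval_eq_eval]
  refine ⟨fun h p hp c _ => h _ (smul_rep_mem_affineCone hp c), fun h v hv => ?_⟩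
  -- The locus only tests nonzero multiples. At the origin, `g` takes the value of its degree-0
  -- component, which vanishes at any point of `X`.
  by_cases hv0 : v = 0
  · obtain ⟨p, hp⟩ := hX
    have := eval_smul_eq_sum_homogeneousComponent g 0 p.rep
    simp only [(forall_ne_zero_eval_smul_iff g _).mp (h hp), mul_zero, Finset.sum_const_zero,
      zero_smul] at this
    rw [hv0]
    exact this
  · obtain ⟨a, ha⟩ := Projectivization.exists_smul_eq_mk_rep K v hv0
    have := h (hv hv0) (↑a⁻¹ : K) (by simp)
    rwa [← ha, ← Units.smul_def, inv_smul_smul] at this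

/-- On the line over a point of `X`, a product vanishes identically only if a factor does, because
`K[t]` is a domain. So the loci of the two factors are closed sets covering `X`, and irreducibility
selects one. -/
theorem isPrime_vanishingIdeal_affineCone [Infinite K] {X : Set (ProjSpace K n)}
    (hX : IsIrreducible X) : (vanishingIdeal K (affineCone X)).IsPrime := by
  refine ⟨fun h => ?_, fun {f g} hfg => ?_⟩
  · have := (Ideal.eq_top_iff_one _).mp h 0 (zero_mem_affineCone X)
    simp at this
  · rw [mem_vanishingIdeal_affineCone_iff hX.nonempty] at hfg
    simp only [mem_vanishingIdeal_affineCone_iff hX.nonempty]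
    refine isPreirreducible_iff_isClosed_union_isClosed.mp hX.isPreirreducible _ _
      (isClosed_lineZeroLocus f) (isClosed_lineZeroLocus g) fun p hp => ?_
    by_contra hcon
    simp only [Set.mem_union, not_or, lineZeroLocus, Set.mem_ofPred_eq,
      forall_ne_zero_eval_smul_iff, not_forall] at hcon
    set P : MvPolynomial (Fin (n + 1)) K → Polynomial K := fun g =>
      aeval (fun j => Polynomial.C (p.rep j) * Polynomial.X) g
    have hP : ∀ g c, (P g).eval c = eval (c • p.rep) g := by
      intro g c
      induction g using MvPolynomial.induction_on with
      | C a => simp [P]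
      | add p q hp hq => simp_all [P]
      | mul_X q j hq =>
        simp only [P, map_mul, aeval_X, Polynomial.eval_mul, Polynomial.eval_C,
          Polynomial.eval_X, eval_X, Pi.smul_apply, smul_eq_mul] at hq ⊢
        rw [hq, mul_comm c]
    have hzero : ∀ g, P g = 0 → ∀ i, eval p.rep (homogeneousComponent i g) = 0 := fun g hg =>
      (forall_ne_zero_eval_smul_iff g _).mp fun c _ => by rw [← hP, hg, Polynomial.eval_zero]
    have hprod : P f * P g = 0 := by
      rw [← map_mul]
      refine Polynomial.eq_zero_of_infinite_isRoot _
        ((Set.infinite_univ.sdiff (Set.finite_singleton (0 : K))).mono fun c hc => ?_)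
      exact (hP (f * g) c).trans (hfg hp c (by simpa using hc))
    obtain ⟨⟨i, hi⟩, j, hj⟩ := hcon
    exact (mul_eq_zero.mp hprod).elim (fun h => hi (hzero f h i)) fun h => hj (hzero g h j)

/-- The homogeneous equations cutting out `X` themselves lie in the ideal of the cone. -/
theorem mem_affineCone_of_forall_eval_eq_zero {X : Set (ProjSpace K n)} (hX : IsClosed X)
    (hne : X.Nonempty) {v : Fin (n + 1) → K}
    (h : ∀ f ∈ vanishingIdeal K (affineCone X), eval v f = 0) :
    v ∈ affineCone X := by
  intro hv
  obtain ⟨S, hS, rfl⟩ := isClosed_iff.mp hX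
  intro f hf
  obtain ⟨d, hd⟩ := hS f hf
  rw [eval_rep_mk_eq_zero_iff hd]
  refine h f fun w hw => ?_
  rw [aeval_eq_eval]
  by_cases hw0 : w = 0
  · obtain ⟨p, hp⟩ := hne
    rw [hw0, ← zero_smul K p.rep, eval_smul_of_isHomogeneous hd, hp f hf, mul_zero]
  · exact (eval_rep_mk_eq_zero_iff hd w hw0).mp (hw hw0 f hf)

/-! ### Directional derivatives and translation invariance -/

/-- The derivative of a polynomial in the direction of a constant vector field. -/
def directionalDeriv (w : Fin (n + 1) → K) (f : MvPolynomial (Fin (n + 1)) K) :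
    MvPolynomial (Fin (n + 1)) K :=
  ∑ i, C (w i) * pderiv i f

/-- The restriction of a polynomial to the parametrized line `t ↦ v + t • w`. -/
def restrictLine (v w : Fin (n + 1) → K) : MvPolynomial (Fin (n + 1)) K →ₐ[K] Polynomial K :=
  aeval fun j => Polynomial.C (v j) + Polynomial.C (w j) * Polynomial.X

theorem eval_restrictLine (v w : Fin (n + 1) → K) (f : MvPolynomial (Fin (n + 1)) K) (t : K) :
    (restrictLine v w f).eval t = eval (v + t • w) f := by
  induction f using MvPolynomial.induction_on with
  | C a => simp [restrictLine]
  | add p q hp hq => simp_all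
  | mul_X q j hq =>
    rw [map_mul, map_mul, Polynomial.eval_mul, hq]
    simp [restrictLine, mul_comm t]

theorem derivative_restrictLine (v w : Fin (n + 1) → K) (f : MvPolynomial (Fin (n + 1)) K) :
    Polynomial.derivative (restrictLine v w f) = restrictLine v w (directionalDeriv w f) := by
  induction f using MvPolynomial.induction_on with
  | C a => simp [restrictLine, directionalDeriv]
  | add p q hp hq =>
    simp only [directionalDeriv, map_add, mul_add, Finset.sum_add_distrib] at *
    rw [hp, hq]
  | mul_X q j hq =>
    have h : directionalDeriv w (q * X j) = directionalDeriv w q * X j + q * C (w j) := by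
      simp only [directionalDeriv, Derivation.leibniz, pderiv_X, smul_eq_mul, mul_add,
        Finset.sum_add_distrib, Finset.sum_mul]
      refine (add_comm _ _).trans (congrArg₂ (· + ·) ?_ ?_)
      · exact Finset.sum_congr rfl fun i _ => by ring
      · rw [Finset.sum_eq_single j (fun i _ hij => by simp [Pi.single_eq_of_ne' hij])
          (by simp)]
        simp [mul_comm]
    rw [h, map_mul, Polynomial.derivative_mul, hq, map_add, map_mul, map_mul]
    simp [restrictLine]

theorem iterate_derivative_restrictLine (v w : Fin (n + 1) → K)
    (f : MvPolynomial (Fin (n + 1)) K) (j : ℕ) :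
    Polynomial.derivative^[j] (restrictLine v w f) =
      restrictLine v w ((directionalDeriv w)^[j] f) := by
  induction j generalizing f with
  | zero => rfl
  | succ j ih => rw [Function.iterate_succ_apply, derivative_restrictLine, ih,
      Function.iterate_succ_apply]

/-- Taylor's formula: if all iterated derivatives of `f` in the direction `w` vanish at `v`, then
`f` vanishes on the line through `v` in the direction `w`. -/
theorem eval_add_smul_eq_zero [CharZero K] {v w : Fin (n + 1) → K}
    {f : MvPolynomial (Fin (n + 1)) K} (h : ∀ j, eval v ((directionalDeriv w)^[j] f) = 0)
    (t : K) : eval (v + t • w) f = 0 := by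
  have hzero : restrictLine v w f = 0 := by
    ext j
    -- The `j`-th derivative at 0 is `j!` times the `j`-th coefficient, and `j!` is invertible.
    have hj := congrArg (Polynomial.eval 0) (iterate_derivative_restrictLine v w f j)
    rw [eval_restrictLine, zero_smul, add_zero, h j, ← Polynomial.coeff_zero_eq_eval_zero,
      Polynomial.coeff_iterate_derivative, zero_add, Nat.descFactorial_self, nsmul_eq_mul] at hj
    exact (mul_eq_zero.mp hj).resolve_left (Nat.cast_ne_zero.mpr j.factorial_ne_zero)
  rw [← eval_restrictLine, hzero, Polynomial.eval_zero]

/-- A vector tangent to `X` at the points of a dense subset defines a constant vector field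
preserving the ideal of the cone over `X`. -/
theorem directionalDeriv_mem_vanishingIdeal [Infinite K] {X : Set (ProjSpace K n)}
    (hX : X.Nonempty) {U : Set X} (hU : Dense U) {w : Fin (n + 1) → K}
    (hw : ∀ p ∈ U, w ∈ zariskiTangentSpace (affineCone X) (p : ProjSpace K n).rep)
    {f : MvPolynomial (Fin (n + 1)) K} (hf : f ∈ vanishingIdeal K (affineCone X)) :
    directionalDeriv w f ∈ vanishingIdeal K (affineCone X) := by
  rw [mem_vanishingIdeal_affineCone_iff hX]
  have hclosed : IsClosed ((↑) ⁻¹' lineZeroLocus (directionalDeriv w f) : Set X) :=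
    (isClosed_lineZeroLocus _).preimage continuous_subtype_val
  have hsub : U ⊆ (↑) ⁻¹' lineZeroLocus (directionalDeriv w f) := by
    intro p hp c hc
    have h := hw p hp
    rw [← zariskiTangentSpace_affineCone_smul X _ hc] at h
    have hsum := h f hf
    simp only [directionalDeriv, map_sum, map_mul, eval_C]
    rw [← hsum]
    exact Finset.sum_congr rfl fun i _ => mul_comm _ _
  have huniv : Set.univ ⊆ ((↑) ⁻¹' lineZeroLocus (directionalDeriv w f) : Set X) :=
    hU.closure_eq.symm.subset.trans (closure_minimal hsub hclosed)
  exact fun p hp => Set.mem_preimage.mp (huniv (Set.mem_univ (⟨p, hp⟩ : X)))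

/-- The cone over a closed set is invariant under translation by vectors that are tangent at all
points of a dense subset. -/
theorem add_mem_affineCone [CharZero K] {X : Set (ProjSpace K n)} (hX : IsClosed X)
    (hne : X.Nonempty) {U : Set X} (hU : Dense U) {v w : Fin (n + 1) → K}
    (hw : ∀ p ∈ U, w ∈ zariskiTangentSpace (affineCone X) (p : ProjSpace K n).rep)
    (hv : v ∈ affineCone X) : v + w ∈ affineCone X := by
  refine mem_affineCone_of_forall_eval_eq_zero hX hne fun f hf => ?_
  have hiter : ∀ j, (directionalDeriv w)^[j] f ∈ vanishingIdeal K (affineCone X) := by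
    intro j
    induction j with
    | zero => exact hf
    | succ j ih =>
      rw [Function.iterate_succ_apply']
      exact directionalDeriv_mem_vanishingIdeal hne hU hw ih
  simpa using eval_add_smul_eq_zero (fun j => hiter j v hv) 1

/-! ### Linear forms and linear subspaces -/

/-- The homogeneous linear polynomial with the same values as a given linear form. -/
def linearFormPoly {σ : Type*} [Fintype σ] [DecidableEq σ] (f : (σ → K) →ₗ[K] K) :
    MvPolynomial σ K :=
  ∑ i, C (f (Pi.single i 1)) * X i

theorem eval_linearFormPoly {σ : Type*} [Fintype σ] [DecidableEq σ] (f : (σ → K) →ₗ[K] K)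
    (v : σ → K) : eval v (linearFormPoly f) = f v := by
  conv_rhs => rw [LinearMap.pi_apply_eq_sum_univ f v]
  simp only [linearFormPoly, map_sum, map_mul, eval_C, eval_X, smul_eq_mul]
  refine Finset.sum_congr rfl fun i _ => ?_
  rw [mul_comm]
  congr 2
  ext j
  simp [Pi.single_apply, eq_comm]

theorem isHomogeneous_linearFormPoly {σ : Type*} [Fintype σ] [DecidableEq σ]
    (f : (σ → K) →ₗ[K] K) : (linearFormPoly f).IsHomogeneous 1 :=
  IsHomogeneous.sum _ _ _ fun i _ => by
    simpa using (isHomogeneous_C _ (f (Pi.single i 1))).mul (isHomogeneous_X K i)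

/-- The pullback of polynomials along a linear map. -/
def linearPullback {σ τ : Type*} [Fintype σ] [DecidableEq σ] (A : (σ → K) →ₗ[K] (τ → K)) :
    MvPolynomial τ K →ₐ[K] MvPolynomial σ K :=
  aeval fun j => linearFormPoly ((LinearMap.proj j).comp A)

theorem eval_linearPullback {σ τ : Type*} [Fintype σ] [DecidableEq σ]
    (A : (σ → K) →ₗ[K] (τ → K)) (v : σ → K) (f : MvPolynomial τ K) :
    eval v (linearPullback A f) = eval (A v) f := by
  induction f using MvPolynomial.induction_on with
  | C a => simp [linearPullback]
  | add p q hp hq => simp_all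
  | mul_X q j hq =>
    rw [map_mul, map_mul, hq]
    simp [linearPullback, eval_linearFormPoly]

theorem mem_projectivization_iff_rep (T : Submodule K (Fin (n + 1) → K)) (p : ProjSpace K n) :
    p ∈ T.projectivization ↔ p.rep ∈ T := by
  rw [← Submodule.mk_mem_projectivization_iff T p.rep_nonzero, Projectivization.mk_rep]

theorem isClosed_projectivization (T : Submodule K (Fin (n + 1) → K)) :
    IsClosed (T.projectivization : Set (ProjSpace K n)) := by
  rw [isClosed_iff]
  refine ⟨{f | f.IsHomogeneous 1 ∧ ∀ v ∈ T, eval v f = 0}, fun f hf => ⟨1, hf.1⟩, ?_⟩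
  ext p
  rw [SetLike.mem_coe, mem_projectivization_iff_rep]
  refine ⟨fun hp f hf => hf.2 _ hp, fun hp => ?_⟩
  by_contra hcon
  obtain ⟨f, hf, hT⟩ := Submodule.exists_le_ker_of_notMem hcon
  refine hf ?_
  rw [← eval_linearFormPoly]
  refine hp _ ⟨isHomogeneous_linearFormPoly f, fun v hv => ?_⟩
  rw [eval_linearFormPoly]
  exact hT hv

/-- If two closed sets cover the subspace and each misses a point, restrict an equation of each to
the line joining these points: the product vanishes although neither factor does. -/
theorem isIrreducible_projectivization [Infinite K] {T : Submodule K (Fin (n + 1) → K)}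
    (hT : T ≠ ⊥) : IsIrreducible (T.projectivization : Set (ProjSpace K n)) := by
  constructor
  · obtain ⟨v, hv, hv0⟩ := T.exists_mem_ne_zero_of_ne_bot hT
    exact ⟨Projectivization.mk K v hv0, hv⟩
  rw [isPreirreducible_iff_isClosed_union_isClosed]
  intro Y Z hY hZ hsub
  by_contra hcon
  simp only [not_or, Set.not_subset] at hcon
  obtain ⟨⟨p, hpT, hpY⟩, q, hqT, hqZ⟩ := hcon
  rw [SetLike.mem_coe, mem_projectivization_iff_rep] at hpT hqT
  obtain ⟨S, hS, rfl⟩ := isClosed_iff.mp hY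
  obtain ⟨R, hR, rfl⟩ := isClosed_iff.mp hZ
  simp only [projZeroLocus, Set.mem_ofPred_eq, not_forall] at hpY hqZ
  obtain ⟨f, hfS, hf⟩ := hpY
  obtain ⟨g, hgR, hg⟩ := hqZ
  obtain ⟨i, hi⟩ := Function.ne_iff.mp p.rep_nonzero
  set r := restrictLine p.rep (q.rep - p.rep)
  -- The line may pass through the origin, which gives no projective point; the factor `X i`
  -- vanishes there but not at `p.rep`.
  have hr : r (f * g * X i) = 0 := by
    refine Polynomial.funext fun t => ?_
    rw [eval_restrictLine, Polynomial.eval_zero]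
    set v := p.rep + t • (q.rep - p.rep)
    by_cases hv : v = 0
    · simp [hv]
    have hvT : v ∈ T := T.add_mem hpT (T.smul_mem t (T.sub_mem hqT hpT))
    obtain ⟨d, hd⟩ := hS f hfS
    obtain ⟨e, he⟩ := hR g hgR
    rcases hsub (show Projectivization.mk K v hv ∈ _ from hvT) with h | h
    · simp [(eval_rep_mk_eq_zero_iff hd v hv).mp (h f hfS)]
    · simp [(eval_rep_mk_eq_zero_iff he v hv).mp (h g hgR)]
  simp only [map_mul, mul_eq_zero] at hr
  rcases hr with (h | h) | h
  · exact hf (by simpa [eval_restrictLine, r] using congrArg (Polynomial.eval 0) h)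
  · exact hg (by simpa [eval_restrictLine, r] using congrArg (Polynomial.eval 1) h)
  · exact hi (by simpa [eval_restrictLine, r] using congrArg (Polynomial.eval 0) h)

theorem isIrreducible_preimage_val {α : Type*} [TopologicalSpace α] {X Z : Set α}
    (hZ : IsIrreducible Z) (hZX : Z ⊆ X) : IsIrreducible ((↑) ⁻¹' Z : Set X) := by
  obtain ⟨z, hz⟩ := hZ.nonempty
  refine ⟨⟨⟨z, hZX hz⟩, hz⟩, ?_⟩
  rintro _ _ ⟨u, hu, rfl⟩ ⟨v, hv, rfl⟩ ⟨a, ha, hau⟩ ⟨b, hb, hbv⟩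
  obtain ⟨c, hc, hcuv⟩ := hZ.isPreirreducible u v hu hv ⟨a, ha, hau⟩ ⟨b, hb, hbv⟩
  exact ⟨⟨c, hZX hc⟩, hc, hcuv⟩

/-- A nonzero submodule, regarded as an irreducible closed subset of a set containing all its
lines. -/
def irreducibleClosedsOfSubmodule [Infinite K] (X : Set (ProjSpace K n))
    (T : Submodule K (Fin (n + 1) → K)) (hT : T ≠ ⊥)
    (hTX : (T.projectivization : Set (ProjSpace K n)) ⊆ X) : IrreducibleCloseds X where
  carrier := (↑) ⁻¹' (T.projectivization : Set (ProjSpace K n))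
  isIrreducible' := isIrreducible_preimage_val (isIrreducible_projectivization hT) hTX
  isClosed' := (isClosed_projectivization T).preimage continuous_subtype_val

/-! ### Lower bound on dimension: flags of subspaces -/

theorem exists_lt_finrank_eq {V : Type*} [AddCommGroup V] [Module K V] [Module.Finite K V]
    {T : Submodule K V} {d : ℕ} (hT : Module.finrank K T = d + 1) :
    ∃ T' < T, Module.finrank K T' = d := by
  obtain ⟨b, hb⟩ := exists_linearIndependent_of_le_finrank (R := K) (M := T) (n := d) (by omega)
  refine ⟨(Submodule.span K (Set.range b)).map T.subtype, ?_, ?_⟩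
  · refine lt_of_le_of_ne (Submodule.map_subtype_le _ _) fun h => ?_
    have := congrArg (fun S : Submodule K V => Module.finrank K S) h
    simp only [Submodule.finrank_map_subtype_eq, finrank_span_eq_card hb, Fintype.card_fin,
      hT] at this
    omega
  · rw [Submodule.finrank_map_subtype_eq, finrank_span_eq_card hb, Fintype.card_fin]

theorem le_height_irreducibleClosedsOfSubmodule [Infinite K] (X : Set (ProjSpace K n)) (d : ℕ)
    (T : Submodule K (Fin (n + 1) → K)) (hT : T ≠ ⊥)
    (hTX : (T.projectivization : Set (ProjSpace K n)) ⊆ X) (hd : Module.finrank K T = d + 1) :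
    (d : ℕ∞) ≤ Order.height (irreducibleClosedsOfSubmodule X T hT hTX) := by
  induction d generalizing T with
  | zero => simp
  | succ d ih =>
    obtain ⟨T', hlt, hd'⟩ := exists_lt_finrank_eq hd
    have hT' : T' ≠ ⊥ := by
      rintro rfl
      simp at hd'
    have hle : (T'.projectivization : Set (ProjSpace K n)) ⊆ T.projectivization :=
      Submodule.projectivization.monotone hlt.le
    refine le_trans ?_ (Order.height_add_one_le
      (a := irreducibleClosedsOfSubmodule X T' hT' (hle.trans hTX)) ?_)
    · push_cast
      gcongr
      exact ih T' hT' _ hd'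
    · refine lt_of_le_not_ge (fun p hp => hle hp) fun hge => hlt.not_ge fun v hv => ?_
      by_cases hv0 : v = 0
      · simp [hv0]
      have hmem : Projectivization.mk K v hv0 ∈ T.projectivization := hv
      exact hge (show (⟨_, hTX hmem⟩ : X) ∈ irreducibleClosedsOfSubmodule X T hT hTX from hmem)

/-- An irreducible set of dimension `k` containing a linear subspace of dimension `k` is equal to
it. -/
theorem eq_projectivization_of_subset [Infinite K] {X : Set (ProjSpace K n)} {k : ℕ}
    (hX : IsIrreducible X) (hX_dim : topologicalKrullDim X = (k : WithBot ℕ∞))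
    {T : Submodule K (Fin (n + 1) → K)} (hT : Module.finrank K T = k + 1)
    (hTX : (T.projectivization : Set (ProjSpace K n)) ⊆ X) :
    X = T.projectivization := by
  refine Set.Subset.antisymm ?_ hTX
  by_contra hcon
  have hT0 : T ≠ ⊥ := by
    rintro rfl
    simp at hT
  -- If the inclusion were strict, `X` itself would extend a flag of length `k` to a chain of length
  -- `k + 1`.
  let Y : IrreducibleCloseds X :=
    ⟨Set.univ, by simpa using isIrreducible_preimage_val hX subset_rfl, isClosed_univ⟩
  have hlt : irreducibleClosedsOfSubmodule X T hT0 hTX < Y :=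
    lt_of_le_not_ge (fun p _ => Set.mem_univ p)
      fun hge => hcon fun p hp => hge (Set.mem_univ (⟨p, hp⟩ : X))
  have h1 : ((k + 1 : ℕ) : ℕ∞) ≤ Order.height Y := by
    refine le_trans ?_ (Order.height_add_one_le hlt)
    push_cast
    gcongr
    exact le_height_irreducibleClosedsOfSubmodule X k T hT0 hTX hT
  have h2 := (WithBot.coe_le_coe.mpr h1).trans (Order.height_le_krullDim Y)
  change _ ≤ topologicalKrullDim X at h2
  rw [hX_dim] at h2
  have : k + 1 ≤ k := by exact_mod_cast h2
  omega

/-! ### Upper bound on dimension: chains of primes -/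

theorem affineCone_mono {X Y : Set (ProjSpace K n)} (h : X ⊆ Y) : affineCone X ⊆ affineCone Y :=
  fun _ hv hv0 => h (hv hv0)

/-- Coordinates on `W`, extended to `V` by a projection, move cones inside `W` to affine `k`-space
without loss. -/
theorem exists_linearMap_leftInverse {V : Type*} [AddCommGroup V] [Module K V]
    [Module.Finite K V] {W : Submodule K V} {k : ℕ} (hW : Module.finrank K W = k) :
    ∃ (A : V →ₗ[K] (Fin k → K)) (B : (Fin k → K) →ₗ[K] V), ∀ w ∈ W, B (A w) = w := by
  obtain ⟨π, hπ⟩ := W.subtype.exists_leftInverse_of_injective W.ker_subtype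
  let e : W ≃ₗ[K] (Fin k → K) := LinearEquiv.ofFinrankEq _ _ (by simp [hW])
  refine ⟨e.toLinearMap.comp π, W.subtype.comp e.symm.toLinearMap, fun w hw => ?_⟩
  have : π w = ⟨w, hw⟩ := LinearMap.congr_fun hπ ⟨w, hw⟩
  simp [this]

/-- The prime ideal of the image under a linear map of the cone over an irreducible set. -/
def conePrime [Infinite K] {k : ℕ} (A : (Fin (n + 1) → K) →ₗ[K] (Fin k → K))
    (Z : Set (ProjSpace K n)) (hZ : IsIrreducible Z) : PrimeSpectrum (MvPolynomial (Fin k) K) :=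
  PrimeSpectrum.comap (linearPullback A).toRingHom
    ⟨vanishingIdeal K (affineCone Z), isPrime_vanishingIdeal_affineCone hZ⟩

theorem mem_conePrime [Infinite K] {k : ℕ} {A : (Fin (n + 1) → K) →ₗ[K] (Fin k → K)}
    {Z : Set (ProjSpace K n)} {hZ : IsIrreducible Z} {f : MvPolynomial (Fin k) K} :
    f ∈ (conePrime A Z hZ).asIdeal ↔ ∀ v ∈ affineCone Z, eval (A v) f = 0 := by
  change linearPullback A f ∈ vanishingIdeal K (affineCone Z) ↔ _
  simp only [mem_vanishingIdeal_iff, aeval_eq_eval]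
  exact forall₂_congr fun v _ => by rw [← eval_linearPullback]

theorem conePrime_anti [Infinite K] {k : ℕ} {A : (Fin (n + 1) → K) →ₗ[K] (Fin k → K)}
    {Y Z : Set (ProjSpace K n)} {hY : IsIrreducible Y} {hZ : IsIrreducible Z} (hYZ : Y ⊆ Z) :
    conePrime A Z hZ ≤ conePrime A Y hY := fun _ hf =>
  mem_conePrime.mpr fun v hv => mem_conePrime.mp hf v (affineCone_mono hYZ hv)

/-- Pulling an equation of the cone over `Y` back along `B` lands in the prime of `Y`, hence in that
of `Z`; as `B ∘ A` fixes the cone over `Z`, the equation holds there. This makes the passage to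
primes strict. -/
theorem subset_of_conePrime_le [Infinite K] {k : ℕ} {A : (Fin (n + 1) → K) →ₗ[K] (Fin k → K)}
    {B : (Fin k → K) →ₗ[K] (Fin (n + 1) → K)} {Y Z : Set (ProjSpace K n)}
    {hY : IsIrreducible Y} {hZ : IsIrreducible Z} (hYc : IsClosed Y)
    (hBY : ∀ v ∈ affineCone Y, B (A v) = v) (hBZ : ∀ v ∈ affineCone Z, B (A v) = v)
    (hle : conePrime A Y hY ≤ conePrime A Z hZ) : Z ⊆ Y := by
  intro p hp
  rw [← rep_mem_affineCone_iff] at hp ⊢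
  refine mem_affineCone_of_forall_eval_eq_zero hYc hY.nonempty fun f hf => ?_
  have h : linearPullback B f ∈ (conePrime A Y hY).asIdeal := by
    refine mem_conePrime.mpr fun v hv => ?_
    rw [eval_linearPullback, hBY v hv]
    exact hf v hv
  have h' := mem_conePrime.mp (hle h) _ hp
  rwa [eval_linearPullback, hBZ _ hp] at h'

/-- The maximal ideal of the origin. -/
def originPrime (K : Type*) [Field K] (k : ℕ) : PrimeSpectrum (MvPolynomial (Fin k) K) :=
  ⟨RingHom.ker (eval (0 : Fin k → K)), RingHom.ker_isPrime _⟩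

theorem conePrime_lt_originPrime [Infinite K] {k : ℕ}
    {A : (Fin (n + 1) → K) →ₗ[K] (Fin k → K)} {B : (Fin k → K) →ₗ[K] (Fin (n + 1) → K)}
    {Z : Set (ProjSpace K n)} {hZ : IsIrreducible Z} (hBZ : ∀ v ∈ affineCone Z, B (A v) = v) :
    conePrime A Z hZ < originPrime K k := by
  refine lt_of_le_not_ge (fun f hf => ?_) fun hge => ?_
  · have := mem_conePrime.mp hf 0 (zero_mem_affineCone Z)
    rwa [map_zero] at this
  · obtain ⟨p, hp⟩ := hZ.nonempty
    rw [← rep_mem_affineCone_iff] at hp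
    refine p.rep_nonzero ?_
    have hA : A p.rep = 0 := by
      ext j
      have hX : (X j : MvPolynomial (Fin k) K) ∈ (originPrime K k).asIdeal := by
        change eval 0 (X j) = 0
        simp
      simpa using mem_conePrime.mp (hge hX) _ hp
    rw [← hBZ _ hp, hA, map_zero]

/-- A nonempty closed subset of a `(k - 1)`-dimensional linear subspace has dimension less
than `k`. -/
theorem topologicalKrullDim_lt_of_subset_projectivization [Infinite K] {X : Set (ProjSpace K n)}
    (hX : IsClosed X) (hne : X.Nonempty) {W : Submodule K (Fin (n + 1) → K)} {k : ℕ}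
    (hW : Module.finrank K W = k) (hXW : affineCone X ⊆ W) :
    topologicalKrullDim X + 1 ≤ k := by
  obtain ⟨A, B, hAB⟩ := exists_linearMap_leftInverse hW
  have hirr : ∀ Z : IrreducibleCloseds X, IsIrreducible ((↑) '' (Z : Set X) : Set (ProjSpace K n)) :=
    fun Z => Z.isIrreducible.image _ continuous_subtype_val.continuousOn
  have hB : ∀ Z : IrreducibleCloseds X, ∀ v ∈ affineCone ((↑) '' (Z : Set X)), B (A v) = v :=
    fun Z v hv => hAB v (hXW (affineCone_mono (Subtype.coe_image_subset X _) hv))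
  -- The adjoined bottom, standing for the empty set, goes to the ideal of the origin, the vertex of
  -- every cone. This extra prime supplies the `+ 1`.
  let F : WithBot (IrreducibleCloseds X) → (PrimeSpectrum (MvPolynomial (Fin k) K))ᵒᵈ :=
    fun Z => OrderDual.toDual (Z.recBotCoe (originPrime K k) fun Z => conePrime A _ (hirr Z))
  have hF : StrictMono F := by
    intro Y Z hYZ
    induction Z using WithBot.recBotCoe with
    | bot => exact (not_lt_bot hYZ).elim
    | coe Z =>
      refine OrderDual.toDual_lt_toDual.mpr ?_
      induction Y using WithBot.recBotCoe with
      | bot => exact conePrime_lt_originPrime (hZ := hirr Z) (hB Z)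
      | coe Y =>
        have hlt := WithBot.coe_lt_coe.mp hYZ
        refine lt_of_le_not_ge
          (conePrime_anti (hY := hirr Y) (hZ := hirr Z) (Set.image_mono hlt.le))
          fun hge => hlt.not_ge ?_
        have hcl := hX.isClosedEmbedding_subtypeVal.isClosedMap _ Y.isClosed
        exact (Set.image_subset_image_iff Subtype.val_injective).mp
          (subset_of_conePrime_le (hY := hirr Y) (hZ := hirr Z) hcl (hB Y) (hB Z) hge)
  have hdim := Order.krullDim_le_of_strictMono F hF
  -- Adjoining a bottom raises the Krull dimension by one only for a nonempty order.
  have : Nonempty (IrreducibleCloseds X) := by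
    obtain ⟨p, hp⟩ := hne
    exact ⟨⟨closure {⟨p, hp⟩}, isIrreducible_singleton.closure, isClosed_closure⟩⟩
  rw [Order.krullDim_withBot, Order.krullDim_orderDual] at hdim
  change topologicalKrullDim X + 1 ≤ ringKrullDim _ at hdim
  simpa using hdim

end ProjVar

end

/-! ### The main theorem -/

theorem mainTheorem7 {K : Type*} [Field K] [IsAlgClosed K] [CharZero K] (n k : ℕ)
    (X : Set (ProjVar.ProjSpace K n)) (hX_closed : IsClosed X) (hX_irr : IsIrreducible X)
    (hX_dim : topologicalKrullDim X = (k : WithBot ℕ∞))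
    (L : Projectivization.Subspace K (Fin (n + 1) → K))
    (hL : ProjVar.HasProjDim L ((k : ℤ) - 1))
    (U₀ : Set X) (hU₀_open : IsOpen U₀) (hU₀_dense : Dense U₀)
    (hU₀ : ∀ p ∈ U₀, L ≤ ProjVar.embeddedTangentSpace X (p : ProjVar.ProjSpace K n)) :
    ∃ T : Projectivization.Subspace K (Fin (n + 1) → K),
      ProjVar.HasProjDim T (k : ℤ) ∧ X = (T : Set (ProjVar.ProjSpace K n)) ∧ L ≤ T := by
  set W := Projectivization.Subspace.submodule L
  have hW : Module.finrank K W = k := by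
    have : (Module.finrank K W : ℤ) = (k : ℤ) - 1 + 1 := hL
    omega
  obtain ⟨x, hx, hxW⟩ : ∃ x ∈ ProjVar.affineCone X, x ∉ W := by
    by_contra! hcon
    have h := ProjVar.topologicalKrullDim_lt_of_subset_projectivization hX_closed
      hX_irr.nonempty hW hcon
    rw [hX_dim] at h
    have : k + 1 ≤ k := by exact_mod_cast h
    omega
  have htangent : ∀ w ∈ W, ∀ p ∈ U₀,
      w ∈ ProjVar.zariskiTangentSpace (ProjVar.affineCone X) (p : ProjVar.ProjSpace K n).rep := by
    intro w hw p hp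
    have h := Projectivization.Subspace.submodule.monotone (hU₀ p hp)
    rw [ProjVar.embeddedTangentSpace, OrderIso.apply_symm_apply] at h
    exact h hw
  set T := W ⊔ Submodule.span K {x}
  have hT : Module.finrank K T = k + 1 := by
    rw [← hW]
    exact Submodule.finrank_sup_span_singleton hxW
  -- A vector of `T` is `c • x + w`: a point of the cone translated by a vector of `W`.
  have hTX : (T.projectivization : Set (ProjVar.ProjSpace K n)) ⊆ X := by
    intro p hp
    rw [SetLike.mem_coe, ProjVar.mem_projectivization_iff_rep] at hp
    obtain ⟨w, hw, y, hy, hwy⟩ := Submodule.mem_sup.mp hp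
    obtain ⟨c, rfl⟩ := Submodule.mem_span_singleton.mp hy
    rw [← ProjVar.rep_mem_affineCone_iff, ← hwy, add_comm w]
    exact ProjVar.add_mem_affineCone hX_closed hX_irr.nonempty hU₀_dense (htangent w hw)
      (ProjVar.smul_mem_affineCone hx c)
  refine ⟨T.projectivization, ?_, ProjVar.eq_projectivization_of_subset hX_irr hX_dim hT hTX, ?_⟩
  · rw [ProjVar.HasProjDim, OrderIso.apply_symm_apply, hT]
    push_cast
    rfl
  · rw [← Projectivization.Subspace.submodule.symm_apply_apply L]
    exact Submodule.projectivization.monotone le_sup_left
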